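/- Setting. Let $(\Omega,\mathcal A,P)$ be a probability space, $(\mathcal S,\preccurlyeq)$ a partially ordered set with a $\sigma$-algebra containing all sets $\{y: y\preccurlyeq x\}$ and $\{y: y\succcurlyeq x\}$, and $X$ an $\mathcal S$-valued random variable. For $x\in\mathcal S$ let $\mathcal C(x)=\{y\in\mathcal S: y\succcurlyeq x\text{ or }y\preccurlyeq x\}$, $p_x=P(X\in\mathcal C(x))$ and $\tau_x=P(X\preccurlyeq x\mid X\in\mathcal C(x))$; for $q>0$ let $\mathcal C_q=\{x\in\mathcal S: p_x\ge q\}$. Let $\mathcal T$ be the class of all sets $\mathcal C(x)$, $\{y: y\preccurlyeq x\}$, $\{y: y\succcurlyeq x\}$ with $x\in\mathcal S$. For data $X_1,X_2,\dots$ let $\mathbb P_n(A)=\frac1n\sum_{i=1}^n 1\{X_i\in A\}$, $\hat p_x=\mathbb P_n(\mathcal C(x))$, and $\hat\tau_x=\mathbb P_n(X_i\preccurlyeq x)/\hat p_x$ if $\hat p_x>0$ and $\hat\tau_x=0$ otherwise. For sets $A\subset\mathcal S$ write $P(A)=P(X\in A)$. Weak convergence in $\ell^\infty(I)$ (bounded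 real functions on $I$ with the supremum norm) is meant in the sense of Hoffmann-Jørgensen: $E^*f(Y_n)\to E f(Z)$ for every bounded continuous $f$, where $E^*$ is outer expectation; limits are tight Borel random elements of $\ell^\infty(I)$. $O_P$ is meant in outer probability. Assumptions. (E.1) $X_1,X_2,\dots$ are i.i.d. with the law of $X$. (E.2) For each $q\in(0,1)$ there are positive numbers $v(q)=v_n(q)$ with $$\sup_{x:\,p_x\ge q}\ \left|\frac{\mathbb P_n(X_i\preccurlyeq x)-P(X\preccurlyeq x)}{p_x}\right|\vee\left|\frac{\mathbb P_n(X_i\succcurlyeq x)-P(X\succcurlyeq x)}{p_x}\right|\vee\left|\frac{\hat p_x-p_x}{p_x}\right| = O_P\!\left(\sqrt{v(q)/n}\right).$$ (E.6) The process $\alpha_n(A)=\sqrt n(\mathbb P_n(A)-P(A))$, $A\in\mathcal T$, converges weakly in $\ell^\infty(\mathcal T)$ to a bounded, mean-zero Gaussian process with covariance function $P(A\cap B)-P(A)P(B)$. Theorem. Assume E.1, E.2 and E.6, let $\bar p>0$ be fixed, and let $v(\bar p)=o(n)$. Then for every $x\in\mathcal C_{\bar p}$, $$\sqrt n(\hat\tau_x-\tau_x)\rightsquigarrow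 N\!\left(0,\frac{\tau_x(1-\tau_x)}{p_x}\right).$$ Moreover, the process $\beta_n(x)=\sqrt n(\hat\tau_x-\tau_x)$ indexed by $x\in\mathcal C_{\bar p}$ converges weakly in $\ell^\infty(\mathcal C_{\bar p})$ to a bounded, mean-zero Gaussian process with covariance function $$\Omega_{z,y}=\tau_z\tau_y\left(\frac{P(X\preccurlyeq z,\,X\preccurlyeq y)}{P(X\preccurlyeq z)P(X\preccurlyeq y)}+\frac{P(\mathcal C(z)\cap\mathcal C(y))}{p_zp_y}-\frac{P(\mathcal C(z)\cap\{X\preccurlyeq y\})}{p_zP(X\preccurlyeq y)}-\frac{P(\{X\preccurlyeq z\}\cap\mathcal C(y))}{P(X\preccurlyeq z)p_y}\right)$$ for $z,y\in\mathcal C_{\bar p}$, where $\Omega_{z,y}$ is read as $0$ if $P(X\preccurlyeq z)=0$ or $P(X\preccurlyeq y)=0$ (then $\tau_z\tau_y=0$). -/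

import Mathlib

open MeasureTheory ProbabilityTheory Filter Topology Asymptotics
open scoped ENNReal BoundedContinuousFunction

namespace PartialQuantile

noncomputable section

/-! ### Weak convergence in `ℓ^∞` -/

/-- The space `ℓ^∞(ι)` of bounded real functions on `ι`, with the supremum norm. -/
abbrev LInf (ι : Type*) : Type _ := lp (fun _ : ι => ℝ) ∞

instance instMeasurableSpaceLInf (ι : Type*) : MeasurableSpace (LInf ι) := borel _

instance instBorelSpaceLInf (ι : Type*) : BorelSpace (LInf ι) := ⟨rfl⟩

/-- The outer expectation `E^* f`: the infimum of the expectations of the measurable integrable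
majorants of `f`. It is only applied to bounded functions `f`, which need not be measurable. -/
def outerExpectation {Ω : Type*} [MeasurableSpace Ω] (P : Measure Ω) (f : Ω → ℝ) : ℝ :=
  sInf {r : ℝ | ∃ U : Ω → ℝ, Measurable U ∧ Integrable U P ∧ (∀ ω, f ω ≤ U ω) ∧
    r = ∫ ω, U ω ∂P}

/-- Weak convergence (in the sense of Hoffmann-Jorgensen) of the sequence of arbitrary maps
`Y n : Ω → E` to the Borel probability measure `L`:
`E^* f(Y n)` tends to `∫ f dL` for every bounded continuous `f : E → ℝ`. -/
def WeaklyConverges {Ω E : Type*} [MeasurableSpace Ω] [TopologicalSpace E] [MeasurableSpace E]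
    (P : Measure Ω) (Y : ℕ → Ω → E) (L : Measure E) : Prop :=
  ∀ f : E →ᵇ ℝ,
    Tendsto (fun n => outerExpectation P (fun ω => f (Y n ω))) atTop (𝓝 (∫ z, f z ∂L))

/-- `L` is the law on `ℓ^∞(ι)` of a tight, bounded, mean zero Gaussian process indexed by `ι`
with covariance function `K`. -/
structure IsGaussianLimitLaw {ι : Type*} (L : Measure (LInf ι)) (K : ι → ι → ℝ) : Prop where
  isProbabilityMeasure : IsProbabilityMeasure L
  tight : IsTightMeasureSet {L}
  gaussian : IsGaussianProcess (fun (t : ι) (z : LInf ι) => z t) L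
  mean_zero : ∀ t : ι, ∫ z : LInf ι, z t ∂L = 0
  covariance_eq : ∀ s t : ι, cov[fun z : LInf ι => z s, fun z : LInf ι => z t; L] = K s t

/-- `Y n = O_P(r n)`, in outer probability (a measure in Mathlib assigns to a set that is not
measurable its outer measure). -/
def IsBigOInProbability {Ω : Type*} [MeasurableSpace Ω] (P : Measure Ω)
    (Y : ℕ → Ω → ℝ) (r : ℕ → ℝ) : Prop :=
  ∀ ε : ℝ, 0 < ε → ∃ M : ℝ, 0 < M ∧ ∃ N : ℕ, ∀ n : ℕ, N ≤ n →
    P {ω | M * r n < |Y n ω|} ≤ ENNReal.ofReal ε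

section Population

variable {Ω S : Type*} [MeasurableSpace Ω] [PartialOrder S]

/-- `𝒞(x)`, the set of points comparable with `x`. -/
def comparableSet (x : S) : Set S := {y | x ≤ y ∨ y ≤ x}

/-- `P(X ∈ A)`. -/
def prob (P : Measure Ω) (X : Ω → S) (A : Set S) : ℝ := P.real (X ⁻¹' A)

/-- `p_x = P(X ∈ 𝒞(x))`, the probability of comparison of `x`. -/
def comparisonProb (P : Measure Ω) (X : Ω → S) (x : S) : ℝ := prob P X (comparableSet x)

/-- The partial quantile index `τ_x = P(X ≼ x | 𝒞(x))`. -/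
def quantileIndex (P : Measure Ω) (X : Ω → S) (x : S) : ℝ :=
  (cond P (X ⁻¹' comparableSet x)).real (X ⁻¹' Set.Iic x)

/-- `𝒞_q`, the set of points whose probability of comparison is at least `q`. -/
def comparableLevel (P : Measure Ω) (X : Ω → S) (q : ℝ) : Set S :=
  {x | q ≤ comparisonProb P X x}

variable (S) in
/-- The class `𝒯` of the sets `𝒞(x)`, `{y | y ≼ x}` and `{y | y ≽ x}`, for `x` in `S`. -/
def orderClass : Set (Set S) :=
  {A | ∃ x : S, A = comparableSet x ∨ A = Set.Iic x ∨ A = Set.Ici x}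

/-- The covariance function `Ω_{z,y}` of the limit of the process of partial quantile indices.
If `P(X ≼ z) = 0`, then `τ_z = 0` and the value is `0`; the same holds for `y`. -/
def indexCovariance (P : Measure Ω) (X : Ω → S) (z y : S) : ℝ :=
  quantileIndex P X z * quantileIndex P X y *
    (prob P X (Set.Iic z ∩ Set.Iic y) / (prob P X (Set.Iic z) * prob P X (Set.Iic y))
      + prob P X (comparableSet z ∩ comparableSet y) /
          (comparisonProb P X z * comparisonProb P X y)
      - prob P X (comparableSet z ∩ Set.Iic y) / (comparisonProb P X z * prob P X (Set.Iic y))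
      - prob P X (Set.Iic z ∩ comparableSet y) / (prob P X (Set.Iic z) * comparisonProb P X y))

end Population

section Sample

variable {Ω S : Type*}

open Classical in
/-- The empirical measure `ℙ_n(A)` of the first `n` observations. -/
def empProb (Xs : ℕ → Ω → S) (n : ℕ) (ω : Ω) (A : Set S) : ℝ :=
  (∑ i ∈ Finset.range n, if Xs i ω ∈ A then (1 : ℝ) else 0) / n

/-- `ℙ_n(A | B) = ℙ_n(A ∩ B) / ℙ_n(B)` if `ℙ_n(B) > 0`, and zero otherwise. -/
def empCondProb (Xs : ℕ → Ω → S) (n : ℕ) (ω : Ω) (A B : Set S) : ℝ :=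
  if 0 < empProb Xs n ω B then empProb Xs n ω (A ∩ B) / empProb Xs n ω B else 0

lemma empProb_nonneg (Xs : ℕ → Ω → S) (n : ℕ) (ω : Ω) (A : Set S) : 0 ≤ empProb Xs n ω A := by
  unfold empProb
  refine div_nonneg (Finset.sum_nonneg fun i _ => ?_) (Nat.cast_nonneg n)
  split_ifs <;> norm_num

lemma empProb_mono (Xs : ℕ → Ω → S) (n : ℕ) (ω : Ω) {A B : Set S} (h : A ⊆ B) :
    empProb Xs n ω A ≤ empProb Xs n ω B := by
  unfold empProb
  refine div_le_div_of_nonneg_right (Finset.sum_le_sum fun i _ => ?_) (Nat.cast_nonneg n)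
  by_cases hA : Xs i ω ∈ A
  · simp [hA, h hA]
  · simp only [hA, if_false]
    split_ifs <;> norm_num

lemma empProb_le_one (Xs : ℕ → Ω → S) (n : ℕ) (ω : Ω) (A : Set S) : empProb Xs n ω A ≤ 1 := by
  refine (empProb_mono Xs n ω (Set.subset_univ A)).trans ?_
  simp only [empProb, Set.mem_univ, if_true, Finset.sum_const, Finset.card_range, nsmul_eq_mul,
    mul_one]
  exact div_self_le_one _

lemma empCondProb_nonneg (Xs : ℕ → Ω → S) (n : ℕ) (ω : Ω) (A B : Set S) :
    0 ≤ empCondProb Xs n ω A B := by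
  unfold empCondProb
  split_ifs
  · exact div_nonneg (empProb_nonneg _ _ _ _) (empProb_nonneg _ _ _ _)
  · exact le_rfl

lemma empCondProb_le_one (Xs : ℕ → Ω → S) (n : ℕ) (ω : Ω) (A B : Set S) :
    empCondProb Xs n ω A B ≤ 1 := by
  unfold empCondProb
  split_ifs with h
  · exact (div_le_one h).2 (empProb_mono _ _ _ Set.inter_subset_right)
  · exact zero_le_one

variable [PartialOrder S]

/-- `p̂_x = ℙ_n(𝒞(x))`. -/
def empComparisonProb (Xs : ℕ → Ω → S) (n : ℕ) (ω : Ω) (x : S) : ℝ :=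
  empProb Xs n ω (comparableSet x)

/-- The estimator `τ̂_x = ℙ_n(X_i ≼ x | 𝒞(x))`. -/
def empQuantileIndex (Xs : ℕ → Ω → S) (n : ℕ) (ω : Ω) (x : S) : ℝ :=
  empCondProb Xs n ω (Set.Iic x) (comparableSet x)

end Sample

lemma memℓp_scaled_diff {ι : Type*} (c : ℝ) (a b : ι → ℝ) (ha0 : ∀ t, 0 ≤ a t)
    (ha1 : ∀ t, a t ≤ 1) (hb0 : ∀ t, 0 ≤ b t) (hb1 : ∀ t, b t ≤ 1) :
    Memℓp (fun t => c * (a t - b t)) ∞ := by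
  refine memℓp_infty ⟨|c|, ?_⟩
  rintro _ ⟨t, rfl⟩
  have h : |a t - b t| ≤ 1 :=
    abs_le.2 ⟨by linarith [ha0 t, hb1 t], by linarith [ha1 t, hb0 t]⟩
  simpa [abs_mul] using mul_le_mul_of_nonneg_left h (abs_nonneg c)

section Processes

variable {Ω S : Type*} [MeasurableSpace Ω] [PartialOrder S]

/-- The empirical process `α_n(A) = √n (ℙ_n(A) - P(A))`, `A ∈ 𝒯`, as an element of `ℓ^∞(𝒯)`. -/
def empProcess (P : Measure Ω) [IsProbabilityMeasure P] (X : Ω → S) (Xs : ℕ → Ω → S)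
    (n : ℕ) (ω : Ω) : LInf (orderClass S) :=
  ⟨fun A => √(n : ℝ) * (empProb Xs n ω A.1 - prob P X A.1),
    memℓp_scaled_diff _ _ _ (fun _ => empProb_nonneg _ _ _ _) (fun _ => empProb_le_one _ _ _ _)
      (fun _ => measureReal_nonneg) (fun _ => measureReal_le_one)⟩

/-- The process `β_n(x) = √n (τ̂_x - τ_x)`, `x ∈ 𝒞_q`, as an element of `ℓ^∞(𝒞_q)`. -/
def indexProcess (P : Measure Ω) [IsProbabilityMeasure P] (X : Ω → S) (Xs : ℕ → Ω → S)
    (q : ℝ) (n : ℕ) (ω : Ω) : LInf (comparableLevel P X q) :=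
  ⟨fun x => √(n : ℝ) * (empQuantileIndex Xs n ω x.1 - quantileIndex P X x.1),
    memℓp_scaled_diff _ _ _ (fun _ => empCondProb_nonneg _ _ _ _ _)
      (fun _ => empCondProb_le_one _ _ _ _ _) (fun _ => measureReal_nonneg) (fun x => by
        rcases eq_zero_or_neZero (cond P (X ⁻¹' comparableSet x.1)) with h | h
        · simp [quantileIndex, h]
        · have : IsProbabilityMeasure (cond P (X ⁻¹' comparableSet x.1)) := by
            apply cond_isProbabilityMeasure
            intro h0
            exact h.out (cond_eq_zero_of_meas_eq_zero h0)
          exact measureReal_le_one)⟩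

/-- The data are independent and distributed as `X`. -/
structure ConditionE1 [MeasurableSpace S] (P : Measure Ω) (X : Ω → S) (Xs : ℕ → Ω → S) :
    Prop where
  indep : iIndepFun Xs P
  identDistrib : ∀ i, IdentDistrib (Xs i) X P P

/-- Uniform deviation bound: for every level `q ∈ (0, 1)`, the relative deviations of
`ℙ_n(X_i ≼ x)`, `ℙ_n(X_i ≽ x)` and `p̂_x` are `O_P(√(v(q) / n))`, uniformly over `𝒞_q`.
The positive number `v(q)` may depend on `n`. The supremum is over a bounded family. -/
def ConditionE2 (P : Measure Ω) (X : Ω → S) (Xs : ℕ → Ω → S) (v : ℝ → ℕ → ℝ) : Prop :=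
  ∀ q : ℝ, 0 < q → q < 1 → (∀ n, 0 < v q n) ∧
    IsBigOInProbability P
      (fun n ω => ⨆ x : comparableLevel P X q,
        max (max
          |(empProb Xs n ω (Set.Iic x.1) - prob P X (Set.Iic x.1)) / comparisonProb P X x.1|
          |(empProb Xs n ω (Set.Ici x.1) - prob P X (Set.Ici x.1)) / comparisonProb P X x.1|)
          |(empComparisonProb Xs n ω x.1 - comparisonProb P X x.1) / comparisonProb P X x.1|)
      (fun n => √(v q n / n))

/-- Functional central limit theorem over `𝒯`: the empirical process converges weakly in
`ℓ^∞(𝒯)` to a bounded mean zero Gaussian process with covariance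
`P(A ∩ B) - P(A) P(B)`. -/
def ConditionE6 (P : Measure Ω) [IsProbabilityMeasure P] (X : Ω → S) (Xs : ℕ → Ω → S) : Prop :=
  ∃ L : Measure (LInf (orderClass S)),
    IsGaussianLimitLaw L
      (fun A B => prob P X (A.1 ∩ B.1) - prob P X A.1 * prob P X B.1) ∧
    WeaklyConverges P (empProcess P X Xs) L

end Processes

end

end PartialQuantile

namespace PartialQuantile

/-! ### Outer expectation. -/

section OuterExpectation

variable {Ω : Type*} [MeasurableSpace Ω] {P : Measure Ω}

/-! This is the delta method for a ratio. Since `{y ≼ x} ⊆ 𝒞(x)`, `τ_x = P(X ≼ x) / p_x`. Put `ℓ =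
(α_n(≼ x) - τ_x α_n(𝒞(x))) / p_x`, the derivative of the ratio applied to `α_n`. When `p̂_x > 0`
there is an exact identity `β_n(x) = ℓ p_x / p̂_x`, so the error of linearization is `ℓ (p_x - p̂_x)
/ p̂_x`. As `p_x ≥ q`, it is of order `‖α_n‖² / (q² √n)` uniformly in `x` (`dist_indexProcess_le`),
and `α_n ↦ ℓ` is a bounded linear map `T` (`indexDerivative`).

`WeaklyConverges.map_of_approx` then transfers the limit law `L` of `α_n` to `L.map T`. It needs the
approximation only on balls `‖α_n‖ ≤ R`, because tightness of `L` controls the rest.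
`IsGaussianLimitLaw.map_indexDerivative` computes the image law, and evaluation at one `x` gives the
pointwise statement. -/

/-- The bounds `a` and `b` keep the two infima away from the default value of `sInf`: `a` bounds the
majorant integrals of `f` below, and `b` supplies a majorant of `g`. -/
lemma outerExpectation_mono [IsProbabilityMeasure P] {f g : Ω → ℝ} {a b : ℝ} (ha : ∀ ω, a ≤ f ω) (hb : ∀ ω, g ω ≤ b)
    (h : ∀ ω, f ω ≤ g ω) : outerExpectation P f ≤ outerExpectation P g := by
  refine csInf_le_csInf ⟨a, ?_⟩ ⟨b, fun _ => b, measurable_const, integrable_const _, hb, ?_⟩ ?_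
  · rintro r ⟨U, -, hU, hfU, rfl⟩
    calc a = ∫ _, a ∂P := by simp
      _ ≤ ∫ ω, U ω ∂P := integral_mono (integrable_const _) hU fun ω => (ha ω).trans (hfU ω)
  · simp
  · rintro r ⟨U, hUm, hU, hgU, rfl⟩
    exact ⟨U, hUm, hU, fun ω => (h ω).trans (hgU ω), rfl⟩

lemma outerExpectation_eq_integral {f : Ω → ℝ} (hf : Measurable f) (hfi : Integrable f P) :
    outerExpectation P f = ∫ ω, f ω ∂P := by
  refine IsLeast.csInf_eq ⟨⟨f, hf, hfi, fun _ => le_rfl, rfl⟩, ?_⟩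
  rintro r ⟨U, -, hU, hfU, rfl⟩
  exact integral_mono hfi hU hfU

end OuterExpectation

/-! ### Weak convergence under asymptotically linear maps. -/

section WeakConvergence

variable {Ω E F : Type*} [MeasurableSpace Ω] {P : Measure Ω} [IsProbabilityMeasure P]

/-- A continuous `[0, 1]`-valued function that vanishes on `K`
and is `1` at distance at least `δ` from `K`. -/
noncomputable def distCutoff [PseudoMetricSpace E] (K : Set E) (δ : ℝ) : E →ᵇ ℝ :=
  BoundedContinuousFunction.ofNormedAddCommGroup
    (fun z => min 1 (|Metric.infDist z K / δ|)) (by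
      have := Metric.continuous_infDist_pt K
      fun_prop) 1 (fun z => by
        rw [Real.norm_of_nonneg (le_min zero_le_one (abs_nonneg _))]
        exact min_le_left _ _)

lemma distCutoff_apply [PseudoMetricSpace E] (K : Set E) (δ : ℝ) (z : E) :
    distCutoff K δ z = min 1 (|Metric.infDist z K / δ|) := rfl

lemma integral_distCutoff_le [PseudoMetricSpace E] [MeasurableSpace E] [BorelSpace E]
    (L : Measure E) [IsProbabilityMeasure L] {K : Set E} (hK : MeasurableSet K) (δ : ℝ) :
    ∫ z, distCutoff K δ z ∂L ≤ L.real Kᶜ := by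
  rw [← integral_indicator_one hK.compl]
  refine integral_mono ((distCutoff K δ).integrable L)
    ((integrable_const (1 : ℝ)).indicator hK.compl) fun z => ?_
  by_cases hz : z ∈ K
  · simp [distCutoff_apply, hz, Metric.infDist_zero_of_mem]
  · simp [distCutoff_apply, hz]

/-- A sequence `W n` that is asymptotically a continuous linear image of a weakly convergent
sequence `Y n`, uniformly while `Y n` stays bounded, converges weakly to the image of the limit. -/
lemma WeaklyConverges.map_of_approx [NormedAddCommGroup E] [NormedSpace ℝ E] [MeasurableSpace E]
    [BorelSpace E] [NormedAddCommGroup F] [NormedSpace ℝ F] [MeasurableSpace F] [BorelSpace F]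
    {Y : ℕ → Ω → E} {W : ℕ → Ω → F} {L : Measure E} [IsProbabilityMeasure L]
    (hY : WeaklyConverges P Y L) (hL : IsTightMeasureSet {L}) (T : E →L[ℝ] F)
    (hW : ∀ R ε : ℝ, 0 < ε → ∀ᶠ n in atTop, ∀ ω, ‖Y n ω‖ ≤ R → dist (W n ω) (T (Y n ω)) < ε) :
    WeaklyConverges P W (L.map T) := by
  intro f
  have hTm : Measurable T := T.continuous.measurable
  rw [integral_map hTm.aemeasurable f.continuous.aestronglyMeasurable]
  set fT : E →ᵇ ℝ := f.compContinuous ⟨T, T.continuous⟩ with hfT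
  have hfTa : ∀ z, fT z = f (T z) := fun z => rfl
  -- The error is dominated by a continuous function of `Y n` alone. Hence `f (W n)` is squeezed
  -- between `fT - φ` and `fT + φ` at `Y n`, and monotonicity of the outer expectation suffices,
  -- with no additivity.
  have key : ∀ ε : ℝ, 0 < ε → ∃ φ : E →ᵇ ℝ, (∀ z, 0 ≤ φ z) ∧ ∫ z, φ z ∂L ≤ ε ∧
      ∀ᶠ n in atTop, ∀ ω, |f (W n ω) - f (T (Y n ω))| ≤ φ (Y n ω) := by
    intro ε hε
    -- `2 * ‖f‖` bounds any difference of values of `f`; the `1` keeps `M` positive.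
    set M : ℝ := 2 * ‖f‖ + 1 with hM
    have hM0 : 0 < M := by positivity
    obtain ⟨K₀, hK₀, hLK₀⟩ := isTightMeasureSet_iff_exists_isCompact_measure_compl_le.1 hL
      (ENNReal.ofReal (ε / (2 * M))) (by simp; positivity)
    -- Adding `0` makes the compact set nonempty, as distances to it require.
    set K : Set E := insert 0 K₀ with hKdef
    have hK : IsCompact K := hK₀.insert 0
    have hKne : K.Nonempty := ⟨0, Set.mem_insert _ _⟩
    have hLK : L.real Kᶜ ≤ ε / (2 * M) := by
      refine ENNReal.toReal_le_of_le_ofReal (by positivity) ?_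
      exact (measure_mono (Set.compl_subset_compl.2 (Set.subset_insert _ _))).trans
        (hLK₀ L rfl)
    -- `f` need not be uniformly continuous, but near the compact set `T '' K` one modulus `η`
    -- serves all its points, against arbitrary points of `F`.
    have hu := (hK.image T.continuous).uniformContinuousAt_of_continuousAt f
      (fun a _ => f.continuous.continuousAt)
      (Metric.dist_mem_uniformity (show 0 < ε / 4 by positivity))
    obtain ⟨η, hη, hfη⟩ := Metric.mem_uniformity_dist.1 hu
    have hfη' : ∀ k ∈ K, ∀ w, dist (T k) w < η → |f (T k) - f w| < ε / 4 := fun k hk w hw =>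
      hfη hw ⟨k, hk, rfl⟩
    set δ : ℝ := η / (2 * (‖T‖ + 1)) with hδdef
    have hT0 := norm_nonneg T
    have hδ : 0 < δ := by positivity
    have hTδ : ‖T‖ * δ < η / 2 := by
      have : (‖T‖ + 1) * δ = η / 2 := by rw [hδdef]; field_simp
      nlinarith
    obtain ⟨R, hR⟩ := hK.isBounded.exists_norm_le
    -- Within `δ` of `K` the constant covers the error, by two comparisons with a point of `T '' K`;
    -- farther away the cutoff is `1` and `M` covers it.
    refine ⟨BoundedContinuousFunction.const E (ε / 2) + M • distCutoff K δ, fun z => ?_, ?_, ?_⟩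
    · have : 0 ≤ distCutoff K δ z := le_min zero_le_one (abs_nonneg _)
      simp only [BoundedContinuousFunction.coe_add, Pi.add_apply,
        BoundedContinuousFunction.const_apply, BoundedContinuousFunction.coe_smul, smul_eq_mul]
      positivity
    · have hi := (distCutoff K δ).integrable L
      simp only [BoundedContinuousFunction.coe_add, Pi.add_apply,
        BoundedContinuousFunction.const_apply, BoundedContinuousFunction.coe_smul, smul_eq_mul]
      rw [integral_add (integrable_const _) (hi.const_mul M), integral_const_mul]
      have h1 := (integral_distCutoff_le L hK.measurableSet δ).trans hLK
      have h2 : M * ∫ z, distCutoff K δ z ∂L ≤ M * (ε / (2 * M)) := by gcongr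
      have h3 : M * (ε / (2 * M)) = ε / 2 := by field_simp
      simp only [integral_const, probReal_univ, one_smul]
      linarith
    · filter_upwards [hW (R + δ) (η / 2) (by positivity)] with n hn ω
      simp only [BoundedContinuousFunction.coe_add, Pi.add_apply,
        BoundedContinuousFunction.const_apply, BoundedContinuousFunction.coe_smul, smul_eq_mul,
        distCutoff_apply]
      rcases lt_or_ge (Metric.infDist (Y n ω) K) δ with h | h
      · obtain ⟨k, hk, hkd⟩ := (Metric.infDist_lt_iff hKne).1 h
        have hYR : ‖Y n ω‖ ≤ R + δ := by
          have := norm_le_norm_add_norm_sub' (Y n ω) k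
          rw [← dist_eq_norm] at this
          linarith [hR k hk]
        have h1 := hn ω hYR
        have h2 : dist (T k) (T (Y n ω)) < η / 2 := by
          rw [dist_comm]
          refine lt_of_le_of_lt (T.lipschitz.dist_le_mul _ _) (lt_of_le_of_lt ?_ hTδ)
          exact mul_le_mul_of_nonneg_left hkd.le hT0
        have h3 := hfη' k hk (T (Y n ω)) (by linarith)
        have h4 := hfη' k hk (W n ω) (by
          have := dist_triangle_right (T k) (W n ω) (T (Y n ω))
          linarith)
        have h5 : 0 ≤ M * min 1 |Metric.infDist (Y n ω) K / δ| :=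
          mul_nonneg hM0.le (le_min zero_le_one (abs_nonneg _))
        rw [abs_lt] at h3 h4
        rw [abs_le]
        constructor <;> linarith
      · have h1 : (1 : ℝ) ≤ |Metric.infDist (Y n ω) K / δ| :=
          ((one_le_div hδ).2 h).trans (le_abs_self _)
        rw [min_eq_left h1]
        have h2 := f.norm_coe_le_norm (W n ω)
        have h3 := f.norm_coe_le_norm (T (Y n ω))
        rw [Real.norm_eq_abs, abs_le] at h2 h3
        rw [abs_le]
        constructor <;> linarith
  have hfb : ∀ (g : E →ᵇ ℝ) z, -‖g‖ ≤ g z ∧ g z ≤ ‖g‖ := fun g z =>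
    abs_le.1 (g.norm_coe_le_norm z)
  have hfb' : ∀ z, -‖f‖ ≤ f z ∧ f z ≤ ‖f‖ := fun z => abs_le.1 (f.norm_coe_le_norm z)
  rw [Metric.tendsto_nhds]
  intro ε hε
  obtain ⟨φ, hφ0, hφ, hev⟩ := key (ε / 2) (by positivity)
  have hu := Metric.tendsto_nhds.1 (hY (fT + φ)) (ε / 2) (by positivity)
  have hl := Metric.tendsto_nhds.1 (hY (fT - φ)) (ε / 2) (by positivity)
  have iu : ∫ z, (fT + φ) z ∂L = ∫ z, f (T z) ∂L + ∫ z, φ z ∂L :=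
    integral_add (fT.integrable L) (φ.integrable L)
  have il : ∫ z, (fT - φ) z ∂L = ∫ z, f (T z) ∂L - ∫ z, φ z ∂L :=
    integral_sub (fT.integrable L) (φ.integrable L)
  filter_upwards [hev, hu, hl] with n hn hun hln
  rw [Real.dist_eq, abs_lt] at hun hln ⊢
  have mu : outerExpectation P (fun ω => f (W n ω)) ≤
      outerExpectation P (fun ω => (fT + φ) (Y n ω)) :=
    outerExpectation_mono (fun ω => (hfb' _).1) (fun ω => (hfb _ _).2) fun ω => by
      have := (abs_le.1 (hn ω)).2
      simp only [BoundedContinuousFunction.coe_add, Pi.add_apply, hfTa]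
      linarith
  have ml : outerExpectation P (fun ω => (fT - φ) (Y n ω)) ≤
      outerExpectation P (fun ω => f (W n ω)) :=
    outerExpectation_mono (fun ω => (hfb _ _).1) (fun ω => (hfb' _).2) fun ω => by
      have := (abs_le.1 (hn ω)).1
      simp only [BoundedContinuousFunction.coe_sub, Pi.sub_apply, hfTa]
      linarith
  constructor <;> linarith

/-- Weak convergence in the sense of outer expectations, followed by a continuous map under which
the sequence becomes a sequence of random variables, gives convergence in distribution. -/
lemma WeaklyConverges.tendstoInDistribution_comp [TopologicalSpace E] [MeasurableSpace E]
    [BorelSpace E] {Y : ℕ → Ω → E} {L : Measure E} [IsProbabilityMeasure L]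
    (hY : WeaklyConverges P Y L) {g : E → ℝ} (hg : Continuous g)
    (hm : ∀ n, Measurable fun ω => g (Y n ω)) (μ : Measure ℝ) [IsProbabilityMeasure μ]
    (hμ : L.map g = μ) :
    TendstoInDistribution (fun n ω => g (Y n ω)) atTop (fun t : ℝ => t) (fun _ => P) μ where
  forall_aemeasurable n := (hm n).aemeasurable
  aemeasurable_limit := aemeasurable_id
  tendsto := by
    refine ProbabilityMeasure.tendsto_iff_forall_integral_tendsto.2 fun f => ?_
    have h := hY (f.compContinuous ⟨g, hg⟩)
    have hlim : ∫ z, (f.compContinuous ⟨g, hg⟩) z ∂L = ∫ t, f t ∂(μ.map fun t => t) := by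
      rw [Measure.map_id', ← hμ,
        integral_map hg.measurable.aemeasurable f.continuous.aestronglyMeasurable]
      rfl
    rw [hlim] at h
    refine h.congr fun n => ?_
    have hfm : Measurable fun ω => f (g (Y n ω)) := f.continuous.measurable.comp (hm n)
    have hfi : Integrable (fun ω => f (g (Y n ω))) P :=
      Integrable.of_bound hfm.aestronglyMeasurable ‖f‖
        (Eventually.of_forall fun ω => f.norm_coe_le_norm _)
    exact (outerExpectation_eq_integral hfm hfi).trans
      (integral_map (hm n).aemeasurable f.continuous.aestronglyMeasurable).symm

end WeakConvergence

/-! ### Population quantities. -/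

section Population

lemma prob_nonneg {Ω S : Type*} [MeasurableSpace Ω] (P : Measure Ω) (X : Ω → S) (A : Set S) :
    0 ≤ prob P X A := measureReal_nonneg

lemma prob_mono {Ω S : Type*} [MeasurableSpace Ω] (P : Measure Ω) [IsFiniteMeasure P]
    (X : Ω → S) {A B : Set S} (h : A ⊆ B) : prob P X A ≤ prob P X B :=
  measureReal_mono (Set.preimage_mono h)

variable {Ω S : Type*} [MeasurableSpace Ω] [PartialOrder S]

lemma Iic_subset_comparableSet (x : S) : Set.Iic x ⊆ comparableSet x := fun _ h => Or.inr h

lemma measurableSet_comparableSet [MeasurableSpace S]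
    (hIic : ∀ x : S, MeasurableSet (Set.Iic x)) (hIci : ∀ x : S, MeasurableSet (Set.Ici x))
    (x : S) : MeasurableSet (comparableSet x) :=
  (hIci x).union (hIic x)

lemma prob_comparableSet (P : Measure Ω) (X : Ω → S) (x : S) :
    prob P X (comparableSet x) = comparisonProb P X x := rfl

/-- No positivity is needed: if `p_x = 0`, both sides are `0` by convention. -/
lemma quantileIndex_eq [MeasurableSpace S] {P : Measure Ω} {X : Ω → S} (hX : Measurable X)
    {x : S} (hC : MeasurableSet (comparableSet x)) :
    quantileIndex P X x = prob P X (Set.Iic x) / comparisonProb P X x := by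
  rw [quantileIndex, measureReal_def, cond_apply (hX hC), ← Set.preimage_inter,
    Set.inter_eq_right.2 (Iic_subset_comparableSet x), comparisonProb, prob, prob, div_eq_inv_mul,
    ENNReal.toReal_mul, ENNReal.toReal_inv]
  rfl

variable (P : Measure Ω) (X : Ω → S)

lemma quantileIndex_nonneg (x : S) : 0 ≤ quantileIndex P X x := measureReal_nonneg

lemma quantileIndex_le_one [IsProbabilityMeasure P] (x : S) : quantileIndex P X x ≤ 1 := by
  rcases eq_zero_or_neZero (cond P (X ⁻¹' comparableSet x)) with h | h
  · simp [quantileIndex, h]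
  · have : IsProbabilityMeasure (cond P (X ⁻¹' comparableSet x)) :=
      cond_isProbabilityMeasure fun h0 => h.out (cond_eq_zero_of_meas_eq_zero h0)
    exact measureReal_le_one

/-- `{y | y ≼ x}` as a member of the class `𝒯`. -/
def lowerSetMem (x : S) : orderClass S := ⟨Set.Iic x, x, Or.inr (Or.inl rfl)⟩

/-- `𝒞(x)` as a member of the class `𝒯`. -/
def comparableSetMem (x : S) : orderClass S := ⟨comparableSet x, x, Or.inl rfl⟩

end Population

/-! ### Linearization of the quantile index. -/

section Linearization

variable {Ω S : Type*} [MeasurableSpace Ω] [PartialOrder S]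
  (P : Measure Ω) [IsProbabilityMeasure P] (X : Ω → S)

/-- Uses `τ_x ≤ 1` and `p_x ≥ q`. The bound serves both for membership in `ℓ^∞` and for continuity
of the derivative. -/
lemma abs_linearization_le {q : ℝ} (hq : 0 < q) {x : S} (hx : q ≤ comparisonProb P X x)
    (z : LInf (orderClass S)) :
    ‖(z (lowerSetMem x) - quantileIndex P X x * z (comparableSetMem x)) /
      comparisonProb P X x‖ ≤ 2 / q * ‖z‖ := by
  have h1 := lp.norm_apply_le_norm ENNReal.top_ne_zero z (lowerSetMem x)
  have h2 := lp.norm_apply_le_norm ENNReal.top_ne_zero z (comparableSetMem x)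
  have h3 : ‖quantileIndex P X x * z (comparableSetMem x)‖ ≤ 1 * ‖z‖ := by
    rw [norm_mul, Real.norm_of_nonneg (quantileIndex_nonneg P X x)]
    exact mul_le_mul (quantileIndex_le_one P X x) h2 (norm_nonneg _) zero_le_one
  rw [norm_div, Real.norm_of_nonneg (hq.le.trans hx), div_mul_eq_mul_div]
  refine div_le_div₀ (by positivity) ((norm_sub_le _ _).trans ?_) hq hx
  linarith

/-- The derivative of the map from the probabilities of the sets in `𝒯` to the partial quantile
indices at level `q`. -/
noncomputable def indexDerivative {q : ℝ} (hq : 0 < q) :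
    LInf (orderClass S) →L[ℝ] LInf (comparableLevel P X q) :=
  LinearMap.mkContinuous
    { toFun := fun z => ⟨fun x => (z (lowerSetMem x.1) -
          quantileIndex P X x.1 * z (comparableSetMem x.1)) / comparisonProb P X x.1,
        memℓp_infty ⟨2 / q * ‖z‖, by
          rintro _ ⟨x, rfl⟩
          exact abs_linearization_le P X hq x.2 z⟩⟩
      map_add' := fun z w => by
        ext x
        simp only [lp.coeFn_add, Pi.add_apply]
        ring
      map_smul' := fun c z => by
        ext x
        simp only [lp.coeFn_smul, Pi.smul_apply, smul_eq_mul, RingHom.id_apply]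
        ring }
    (2 / q)
    (fun z => lp.norm_le_of_forall_le (by positivity)
      fun x => abs_linearization_le P X hq x.2 z)

lemma indexDerivative_apply {q : ℝ} (hq : 0 < q) (z : LInf (orderClass S))
    (x : comparableLevel P X q) :
    indexDerivative P X hq z x = (z (lowerSetMem x.1) -
      quantileIndex P X x.1 * z (comparableSetMem x.1)) / comparisonProb P X x.1 := rfl

variable {P X} [MeasurableSpace S]

/-- The linearization of the process of partial quantile indices, with the remainder bounded in
terms of the norm of the empirical process. -/
lemma dist_indexProcess_le (hX : Measurable X)
    (hC : ∀ x : S, MeasurableSet (comparableSet x)) (Xs : ℕ → Ω → S) {q : ℝ} (hq : 0 < q)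
    {n : ℕ} {ω : Ω} {R : ℝ} (hR : ‖(empProcess P X Xs n ω)‖ ≤ R) (hn : 2 * R < q * √(n : ℝ)) :
    dist (indexProcess P X Xs q n ω) (indexDerivative P X hq (empProcess P X Xs n ω)) ≤
      4 * R ^ 2 / q ^ 2 / √(n : ℝ) := by
  have hR0 : 0 ≤ R := (norm_nonneg _).trans hR
  have hs : 0 < √(n : ℝ) := by
    by_contra h
    nlinarith [Real.sqrt_nonneg (n : ℝ)]
  rw [dist_eq_norm]
  refine lp.norm_le_of_forall_le (by positivity) fun x => ?_
  obtain ⟨x, hx⟩ := x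
  have hp : 0 < comparisonProb P X x := hq.trans_le hx
  have hx' : q ≤ comparisonProb P X x := hx
  have hlin := abs_linearization_le P X hq hx (empProcess P X Xs n ω)
  have hCR := (lp.norm_apply_le_norm ENNReal.top_ne_zero (empProcess P X Xs n ω)
    (comparableSetMem x)).trans hR
  rw [lp.coeFn_sub, Pi.sub_apply, indexDerivative_apply]
  have e1 : empProcess P X Xs n ω (lowerSetMem x) =
    √(n : ℝ) * (empProb Xs n ω (Set.Iic x) - prob P X (Set.Iic x)) := rfl
  have e2 : empProcess P X Xs n ω (comparableSetMem x) =
    √(n : ℝ) * (empProb Xs n ω (comparableSet x) - comparisonProb P X x) := rfl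
  have e3 : indexProcess P X Xs q n ω ⟨x, hx⟩ =
    √(n : ℝ) * (empCondProb Xs n ω (Set.Iic x) (comparableSet x) - quantileIndex P X x) := rfl
  have hτ := quantileIndex_eq (P := P) hX (hC x)
  set ℓ : ℝ := (empProcess P X Xs n ω (lowerSetMem x) -
    quantileIndex P X x * empProcess P X Xs n ω (comparableSetMem x)) /
      comparisonProb P X x with hℓ
  set s := √(n : ℝ)
  set p := comparisonProb P X x
  set pn := empProb Xs n ω (comparableSet x)
  have hdev : s * |pn - p| ≤ R := by
    rw [e2, norm_mul, Real.norm_of_nonneg hs.le, Real.norm_eq_abs] at hCR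
    exact hCR
  -- This is where `2 * R < q * √n` enters: it keeps `p̂_x` at least `q / 2`, away from the default
  -- branch of `empCondProb`.
  have hdev' : |pn - p| ≤ q / 2 := by
    by_contra! h
    nlinarith
  have hpn : q / 2 ≤ pn := by
    have := (abs_le.1 hdev').1
    linarith
  have hpn0 : 0 < pn := by linarith
  have hcond : empCondProb Xs n ω (Set.Iic x) (comparableSet x) =
      empProb Xs n ω (Set.Iic x) / pn := by
    rw [empCondProb, if_pos hpn0, Set.inter_eq_left.2 (Iic_subset_comparableSet x)]
  -- An exact identity rather than a Taylor estimate; each of the factors `ℓ` and `p - pn`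
  -- contributes one `R`.
  have hrem : indexProcess P X Xs q n ω ⟨x, hx⟩ - ℓ = ℓ * (p - pn) / pn := by
    rw [e3, hcond, hℓ, e1, e2, hτ]
    field_simp
    ring
  have hℓR : |ℓ| ≤ 2 / q * R := hlin.trans (by gcongr)
  change ‖(indexProcess P X Xs q n ω) ⟨x, hx⟩ - ℓ‖ ≤ _
  rw [hrem, Real.norm_eq_abs, abs_div, abs_mul, abs_of_pos hpn0, abs_sub_comm p pn]
  have hdev2 : |pn - p| ≤ R / s := (le_div_iff₀ hs).2 (by linarith [mul_comm s |pn - p|])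
  calc |ℓ| * |pn - p| / pn ≤ (2 / q * R) * (R / s) / (q / 2) := by gcongr
    _ = 4 * R ^ 2 / q ^ 2 / s := by field_simp; ring

lemma eventually_dist_indexProcess_lt (hX : Measurable X)
    (hC : ∀ x : S, MeasurableSet (comparableSet x)) (Xs : ℕ → Ω → S) {q : ℝ} (hq : 0 < q)
    (R ε : ℝ) (hε : 0 < ε) :
    ∀ᶠ n in atTop, ∀ ω, ‖(empProcess P X Xs n ω)‖ ≤ R →
      dist (indexProcess P X Xs q n ω) (indexDerivative P X hq (empProcess P X Xs n ω)) < ε := by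
  have hs : Tendsto (fun n : ℕ => √(n : ℝ)) atTop atTop :=
    Real.tendsto_sqrt_atTop.comp tendsto_natCast_atTop_atTop
  filter_upwards [(hs.const_mul_atTop hq).eventually_gt_atTop (2 * R),
    (hs.const_div_atTop (4 * R ^ 2 / q ^ 2)).eventually_lt_const hε] with n h1 h2 ω hω
  exact (dist_indexProcess_le hX hC Xs hq hω h1).trans_lt h2

end Linearization

/-! ### The Gaussian limit and its covariance. -/

section Limit

variable {Ω S : Type*} [MeasurableSpace Ω] [PartialOrder S] [MeasurableSpace S]
  {P : Measure Ω} [IsProbabilityMeasure P] {X : Ω → S}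

lemma continuous_LInf_apply {ι : Type*} (t : ι) : Continuous fun z : LInf ι => z t :=
  (lp.evalCLM ℝ (fun _ : ι => ℝ) ∞ t).continuous

lemma IsGaussianLimitLaw.memLp {ι : Type*} {L : Measure (LInf ι)} {K : ι → ι → ℝ}
    (hL : IsGaussianLimitLaw L K) (t : ι) : MemLp (fun z : LInf ι => z t) 2 L :=
  (hL.gaussian.hasGaussianLaw_eval t).memLp_two

lemma IsGaussianLimitLaw.map_apply {ι : Type*} {L : Measure (LInf ι)} {K : ι → ι → ℝ}
    (hL : IsGaussianLimitLaw L K) (t : ι) :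
    L.map (fun z : LInf ι => z t) = gaussianReal 0 (K t t).toNNReal := by
  rw [(hL.gaussian.hasGaussianLaw_eval t).map_eq_gaussianReal, hL.mean_zero t,
    ← covariance_self (continuous_LInf_apply t).measurable.aemeasurable, hL.covariance_eq t t]

/-- Clearing `P(X ≼ ·)` from the denominators gives the form that bilinearity of the covariance
produces. -/
lemma indexCovariance_eq (hX : Measurable X)
    (hC : ∀ x : S, MeasurableSet (comparableSet x)) {z y : S}
    (hz : 0 < comparisonProb P X z) (hy : 0 < comparisonProb P X y) :
    indexCovariance P X z y =
      (prob P X (Set.Iic z ∩ Set.Iic y)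
        - quantileIndex P X y * prob P X (Set.Iic z ∩ comparableSet y)
        - quantileIndex P X z * prob P X (comparableSet z ∩ Set.Iic y)
        + quantileIndex P X z * quantileIndex P X y *
          prob P X (comparableSet z ∩ comparableSet y)) /
        (comparisonProb P X z * comparisonProb P X y) := by
  have hle : ∀ {A B : Set S}, A ⊆ B → prob P X B = 0 → prob P X A = 0 := fun h hB =>
    le_antisymm ((prob_mono P X h).trans hB.le) (prob_nonneg P X _)
  rw [indexCovariance, quantileIndex_eq hX (hC z), quantileIndex_eq hX (hC y)]
  -- In the degenerate cases the index vanishes, and so do the probabilities of the intersections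
  -- with the null lower set.
  rcases eq_or_ne (prob P X (Set.Iic z)) 0 with h | h
  · simp [h, hle Set.inter_subset_left h]
  rcases eq_or_ne (prob P X (Set.Iic y)) 0 with h' | h'
  · simp [h', hle Set.inter_subset_right h']
  field_simp
  ring

/-- Since `{y ≼ x} ⊆ 𝒞(x)`, the numerator is `τp - 2τ·τp + τ²p = τ(1 - τ)p`. -/
lemma indexCovariance_self (hX : Measurable X)
    (hC : ∀ x : S, MeasurableSet (comparableSet x)) {x : S} (hx : 0 < comparisonProb P X x) :
    indexCovariance P X x x =
      quantileIndex P X x * (1 - quantileIndex P X x) / comparisonProb P X x := by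
  rw [indexCovariance_eq hX hC hx hx, Set.inter_self, Set.inter_self,
    Set.inter_eq_left.2 (Iic_subset_comparableSet x),
    Set.inter_eq_right.2 (Iic_subset_comparableSet x), quantileIndex_eq hX (hC x)]
  rw [prob_comparableSet]
  field_simp
  ring

lemma IsGaussianLimitLaw.map_indexDerivative (hX : Measurable X)
    (hC : ∀ x : S, MeasurableSet (comparableSet x)) {q : ℝ} (hq : 0 < q)
    {L : Measure (LInf (orderClass S))}
    (hL : IsGaussianLimitLaw L
      (fun A B => prob P X (A.1 ∩ B.1) - prob P X A.1 * prob P X B.1)) :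
    IsGaussianLimitLaw (L.map (indexDerivative P X hq))
      (fun z y => indexCovariance P X z.1 y.1) := by
  classical
  have := hL.isProbabilityMeasure
  have hT := (indexDerivative P X hq).continuous
  have hTm := hT.measurable
  have hint : ∀ A, Integrable (fun z : LInf (orderClass S) => z A) L := fun A =>
    (hL.memLp A).integrable (by norm_num)
  refine ⟨Measure.isProbabilityMeasure_map hTm.aemeasurable, ?_, ?_, fun x => ?_, fun x y => ?_⟩
  · simpa using hL.tight.map hT
  · have hG : IsGaussianProcess
        (fun (x : comparableLevel P X q) (z : LInf (orderClass S)) =>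
          indexDerivative P X hq z x) L := by
      -- Each coordinate of the image is a linear function of two coordinates of the original
      -- process, so joint Gaussianity is inherited.
      refine hL.gaussian.of_isGaussianProcess fun x =>
        ⟨{lowerSetMem x.1, comparableSetMem x.1},
          (comparisonProb P X x.1)⁻¹ •
            (ContinuousLinearMap.proj ⟨lowerSetMem x.1, by simp⟩ -
              quantileIndex P X x.1 •
                ContinuousLinearMap.proj ⟨comparableSetMem x.1, by simp⟩), fun z => ?_⟩
      simp [indexDerivative_apply, div_eq_inv_mul]
    refine ⟨fun I => ⟨?_⟩⟩
    have hm : Measurable fun w : LInf (comparableLevel P X q) =>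
        I.restrict (fun x => w x) :=
      measurable_pi_lambda _ fun i => (continuous_LInf_apply i.1).measurable
    rw [Measure.map_map hm hTm]
    exact (hG.hasGaussianLaw I).isGaussian_map
  · rw [integral_map hTm.aemeasurable (continuous_LInf_apply x).aestronglyMeasurable]
    simp only [indexDerivative_apply]
    rw [integral_div, integral_sub (hint _) ((hint _).const_mul _), integral_const_mul,
      hL.mean_zero, hL.mean_zero]
    simp
  · have hm2 := hL.memLp
    rw [covariance_map_fun (continuous_LInf_apply x).aestronglyMeasurable
      (continuous_LInf_apply y).aestronglyMeasurable hTm.aemeasurable,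
      indexCovariance_eq hX hC (hq.trans_le x.2) (hq.trans_le y.2)]
    simp only [indexDerivative_apply]
    rw [covariance_fun_div_left, covariance_fun_div_right,
      covariance_fun_sub_fun_sub (hm2 _) ((hm2 _).const_mul _) (hm2 _) ((hm2 _).const_mul _),
      covariance_const_mul_left, covariance_const_mul_left, covariance_const_mul_right,
      covariance_const_mul_right, hL.covariance_eq, hL.covariance_eq, hL.covariance_eq,
      hL.covariance_eq]
    have hpx : 0 < comparisonProb P X x.1 := hq.trans_le x.2
    have hpy : 0 < comparisonProb P X y.1 := hq.trans_le y.2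
    simp only [lowerSetMem, comparableSetMem]
    -- The product terms `P(A) P(B)` cancel because `P(X ≼ x) - τ_x p_x = 0`.
    rw [quantileIndex_eq hX (hC x.1), quantileIndex_eq hX (hC y.1)]
    simp only [prob_comparableSet]
    field_simp
    ring

end Limit

/-! ### Measurability of the estimators at a fixed point. -/

section Measurability

variable {Ω S : Type*} [MeasurableSpace Ω] [MeasurableSpace S]

lemma measurable_empProb {Xs : ℕ → Ω → S} (hXs : ∀ i, Measurable (Xs i)) (n : ℕ) {A : Set S}
    (hA : MeasurableSet A) : Measurable fun ω => empProb Xs n ω A := by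
  classical
  unfold empProb
  refine (Finset.measurable_fun_sum _ fun i _ => ?_).div_const _
  exact Measurable.ite (hXs i hA) measurable_const measurable_const

lemma measurable_empCondProb {Xs : ℕ → Ω → S} (hXs : ∀ i, Measurable (Xs i)) (n : ℕ)
    {A B : Set S} (hA : MeasurableSet A) (hB : MeasurableSet B) :
    Measurable fun ω => empCondProb Xs n ω A B := by
  unfold empCondProb
  refine Measurable.ite (measurableSet_lt measurable_const (measurable_empProb hXs n hB)) ?_
    measurable_const
  exact (measurable_empProb hXs n (hA.inter hB)).div (measurable_empProb hXs n hB)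

end Measurability

end PartialQuantile

theorem theorem3 {Ω S : Type*} [MeasurableSpace Ω] (P : Measure Ω) [IsProbabilityMeasure P]
    [MeasurableSpace S] [PartialOrder S]
    (hIic : ∀ x : S, MeasurableSet (Set.Iic x)) (hIci : ∀ x : S, MeasurableSet (Set.Ici x))
    (X : Ω → S) (hX : Measurable X) (Xs : ℕ → Ω → S) (hXs : ∀ i, Measurable (Xs i))
    (v : ℝ → ℕ → ℝ)
    (hE1 : PartialQuantile.ConditionE1 P X Xs)
    (hE2 : PartialQuantile.ConditionE2 P X Xs v)
    (hE6 : PartialQuantile.ConditionE6 P X Xs)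
    (q : ℝ) (hq : 0 < q)
    (hv : (fun n : ℕ => v q n) =o[atTop] (fun n : ℕ => (n : ℝ))) :
    (∀ x : S, q ≤ PartialQuantile.comparisonProb P X x →
      TendstoInDistribution
        (fun (n : ℕ) (ω : Ω) =>
          √(n : ℝ) * (PartialQuantile.empQuantileIndex Xs n ω x -
            PartialQuantile.quantileIndex P X x))
        atTop (fun t : ℝ => t) (fun _ => P)
        (gaussianReal 0 (Real.toNNReal
          (PartialQuantile.quantileIndex P X x * (1 - PartialQuantile.quantileIndex P X x) /
            PartialQuantile.comparisonProb P X x)))) ∧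
    (∃ G : Measure (PartialQuantile.LInf (PartialQuantile.comparableLevel P X q)),
      PartialQuantile.IsGaussianLimitLaw G
        (fun z y => PartialQuantile.indexCovariance P X z.1 y.1) ∧
      PartialQuantile.WeaklyConverges P (PartialQuantile.indexProcess P X Xs q) G) := by
  obtain ⟨L, hL, hconv⟩ := hE6
  have hC := PartialQuantile.measurableSet_comparableSet hIic hIci
  have := hL.isProbabilityMeasure
  have hG := hL.map_indexDerivative hX hC hq
  have hβ : PartialQuantile.WeaklyConverges P (PartialQuantile.indexProcess P X Xs q)
      (L.map (PartialQuantile.indexDerivative P X hq)) :=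
    hconv.map_of_approx hL.tight _ (PartialQuantile.eventually_dist_indexProcess_lt hX hC Xs hq)
  refine ⟨fun x hx => ?_, _, hG, hβ⟩
  have := hG.isProbabilityMeasure
  -- At a fixed `x` the estimator is a random variable, so outer expectations become integrals.
  refine hβ.tendstoInDistribution_comp
    (g := fun z : PartialQuantile.LInf (PartialQuantile.comparableLevel P X q) => z ⟨x, hx⟩)
    (PartialQuantile.continuous_LInf_apply _) (fun n => ?_) _ ?_
  · have hm : Measurable fun ω => PartialQuantile.empQuantileIndex Xs n ω x :=
      PartialQuantile.measurable_empCondProb hXs n (hIic x) (hC x)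
    exact (hm.sub_const (PartialQuantile.quantileIndex P X x)).const_mul (√(n : ℝ))
  · rw [hG.map_apply, PartialQuantile.indexCovariance_self hX hC (hq.trans_le hx)]
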